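/- Let $\mathbb D=\{z\in\mathbb C:|z|<1\}$, let $c\in(0,3]$, and let $\mathcal F(c)$ be the class of all functions $f$ analytic in $\mathbb D$ with $f(0)=0$, $f'(0)=1$, with $f'$ non-vanishing in $\mathbb D$, and $$\mathrm{Re}\left(1+\frac{zf''(z)}{f'(z)}\right)>1-\frac c2\qquad(z\in\mathbb D).$$ The logarithmic coefficients $\gamma_n=\gamma_n(f)$ are defined by $\log\frac{f(z)}{z}=2\sum_{n\ge1}\gamma_nz^n$ (expansion at $0$ of the branch that vanishes at $0$). Every $f\in\mathcal F(c)$ satisfies $$|\gamma_1|\le\frac c4,\qquad|\gamma_2|\le\frac{4c+c^2}{48},\qquad|\gamma_3|\le\frac{2c+c^2}{48},$$ $$|\gamma_4|\le\begin{cases}\dfrac1{40}\left[c+\dfrac{c^2}{18}\left(13+\dfrac c2-\dfrac{c^2}8\right)\right]&\text{if }0<c\le\dfrac{144}{55},\\[3mm]\dfrac1{40}\left[c+\dfrac{2c^2}9+\dfrac{c^2}2\cdot\dfrac{54+c}{27}\left(\dfrac{4(54+c)}{3(288+8c-c^2)}\right)^{1/2}\right]&\text{if }2.71569<c\le3,\end{cases}$$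 $$|\gamma_5|\le\begin{cases}\dfrac1{60}\left[c+\dfrac{c^2}{12}\left(11+c-\dfrac{c^2}4\right)\right]&\text{if }0<c<1.31148,\\[3mm]\dfrac1{60}\left[c+\dfrac{c^2}2+\dfrac{c^3}{24}+\dfrac{5c^2}{12}\cdot\dfrac{30+c}{15}\left(\dfrac{2(30+c)}{3(80+4c-c^2)}\right)^{1/2}\right]&\text{if }1.35541<c\le3.\end{cases}$$ Let $f_c(z)=\dfrac{(1-z)^{1-c}-1}{c-1}$ for $c\ne1$ and $f_1(z)=-\log(1-z)$ (principal branches). Then $f_c\in\mathcal F(c)$, and for $f=f_c$ equality holds in the bounds for $|\gamma_1|$, $|\gamma_2|$, $|\gamma_3|$, in the first bound for $|\gamma_4|$ if $c\le\frac{144}{55}$, and in the first bound for $|\gamma_5|$ if $c\le\frac{80}{61}$. -/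

import Mathlib

/-- The class of functions analytic in the open unit disk, normalized by
`f 0 = 0` and `f' 0 = 1`. -/
structure IsNormalizedAnalytic (f : ℂ → ℂ) : Prop where
  differentiableOn : DifferentiableOn ℂ f (Metric.ball 0 1)
  map_zero : f 0 = 0
  deriv_zero : deriv f 0 = 1

/-- The class `F(c)`: normalized analytic `f` with `Re (1 + z f''(z) / f'(z)) > 1 - c / 2` in the
open unit disk. The quotient has to be defined, so `f'` has no zero in the disk; at a zero of `f'`
it would have a pole, while Lean divides by zero. -/
def classF (c : ℝ) : Set (ℂ → ℂ) :=
  {f | IsNormalizedAnalytic f ∧ ∀ z ∈ Metric.ball (0 : ℂ) 1,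
    deriv f z ≠ 0 ∧ 1 - c / 2 < (1 + z * deriv (deriv f) z / deriv f z).re}

/-- The `n`-th logarithmic coefficient `γ_n` of `f`, from `log (f z / z) = 2 ∑ γ_n z ^ n`:
half the `n`-th Taylor coefficient at `0` of `log (f z / z)`. Here `dslope f 0` is the function
`z ↦ f z / z` with its removable singularity at `0` filled in; for a normalized `f` its value there
is `1`, so that the principal logarithm is the analytic branch with value `0`. -/
noncomputable def logCoeff (f : ℂ → ℂ) (n : ℕ) : ℂ :=
  iteratedDeriv n (fun z => Complex.log (dslope f 0 z)) 0 / (n.factorial : ℂ) / 2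

/-- If `L` is any analytic branch of `log (f z / z)` in the unit disk with `L 0 = 0`, then
`logCoeff f n` is half the `n`-th Taylor coefficient of `L`. -/
theorem logCoeff_eq_of_branch {f L : ℂ → ℂ} (hf : IsNormalizedAnalytic f)
    (hL : DifferentiableOn ℂ L (Metric.ball 0 1)) (hL0 : L 0 = 0)
    (h : ∀ z ∈ Metric.ball (0 : ℂ) 1, f z = z * Complex.exp (L z)) (n : ℕ) :
    logCoeff f n = iteratedDeriv n L 0 / (n.factorial : ℂ) / 2 := by
  have hball : Metric.ball (0 : ℂ) 1 ∈ nhds (0 : ℂ) := Metric.ball_mem_nhds _ one_pos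
  have hc : ContinuousAt L 0 := (hL.differentiableAt hball).continuousAt
  have hc1 : ContinuousAt (fun z => (L z).im) 0 := Complex.continuous_im.continuousAt.comp hc
  have him : ∀ᶠ z in nhds (0 : ℂ), (L z).im ∈ Set.Ioo (-Real.pi) Real.pi := by
    apply hc1.eventually_mem
    apply Ioo_mem_nhds <;> simp [hL0, Real.pi_pos]
  have hEq : (fun z => Complex.log (dslope f 0 z)) =ᶠ[nhds 0] L := by
    filter_upwards [hball, him] with z hz hi
    by_cases h0 : z = 0
    · subst h0
      simp [dslope_same, hf.deriv_zero, hL0]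
    · rw [dslope_of_ne _ h0, slope_def_field, hf.map_zero, h z hz, sub_zero, sub_zero,
        mul_div_cancel_left₀ _ h0, Complex.log_exp hi.1 hi.2.le]
  rw [logCoeff, hEq.iteratedDeriv_eq]

/-- The function `f_c(z) = ((1 - z) ^ (1 - c) - 1) / (c - 1)` for `c ≠ 1` and
`f_1(z) = - log (1 - z)` (principal branches). -/
noncomputable def extremalF (c : ℝ) (z : ℂ) : ℂ :=
  if c = 1 then -Complex.log (1 - z) else ((1 - z) ^ (1 - (c : ℂ)) - 1) / ((c : ℂ) - 1)

/-! Put S = z f''/f' and write S = c ∑ q_n z^n. Membership in the class says that 1/2 + S/c has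
positive real part, so the q_n are, up to a limit over circles, the moments ∫ w^n of a probability
measure on the unit circle. Hence |q_n| ≤ 1, and centring at the mean q_1 bounds q_2 - q_1^2 and q_3
- q_1^3 (`coeff_bounds_of_re_nonneg`).

With L = log(f/z) and G = zL', differentiating f = z e^L gives the Riccati equation S(1 + G) = zG' +
G + G^2. It yields γ_1, ..., γ_5 as polynomials in the q_n (`logCoeff_formulas`). The first three
have nonnegative coefficients, so |q_n| ≤ 1 suffices. In γ_4 and γ_5 a negative power of c enters,
and the refined inequalities reduce the estimate to a polynomial in a = |q_1| whose maximum is at a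
= 1 (`norm_fourth_le`, `norm_fifth_le`).

The estimates are the values at q_n = 1, which is the case f = f_c. They hold for all 0 < c ≤ 3; the
square-root expressions dominate them on their ranges. -/

/-! ### Moments of a probability density -/

section Moments

open intervalIntegral

variable {a b : ℝ} {U : ℝ → ℝ} {W : ℝ → ℂ} {ρ : ℝ}

/-- Norm bound for an integral against a nonnegative weight. -/
theorem norm_weighted_integral_le (hab : a ≤ b) (hU : Continuous U) (hU0 : ∀ t, 0 ≤ U t)
    {V : ℝ → ℂ} {B : ℝ → ℝ} (hB : Continuous B) (hVB : ∀ t, ‖V t‖ ≤ B t) :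
    ‖∫ t in a..b, (U t : ℂ) * V t‖ ≤ ∫ t in a..b, U t * B t := by
  refine norm_integral_le_of_norm_le hab ?_ ((hU.mul hB).intervalIntegrable _ _)
  filter_upwards with t _
  rw [norm_mul, Complex.norm_real, Real.norm_of_nonneg (hU0 t)]
  exact mul_le_mul_of_nonneg_left (hVB t) (hU0 t)

/-- Moments of a probability density are bounded by powers of the bound on the variable. -/
theorem norm_moment_le (hab : a ≤ b) (hU : Continuous U) (hU0 : ∀ t, 0 ≤ U t)
    (hWρ : ∀ t, ‖W t‖ ≤ ρ) (h1 : ∫ t in a..b, U t = 1) (n : ℕ) :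
    ‖∫ t in a..b, (U t : ℂ) * W t ^ n‖ ≤ ρ ^ n := by
  have h := norm_weighted_integral_le (V := fun t => W t ^ n) (B := fun _ => ρ ^ n) hab hU hU0
    continuous_const (fun t => by rw [norm_pow]; exact pow_le_pow_left₀ (norm_nonneg _) (hWρ t) n)
  rwa [integral_mul_const, h1, one_mul] at h

/-- The variance is the mean of |W|^2 minus |m|^2, and |W| ≤ ρ. -/
theorem weighted_integral_norm_sub_sq_le (hab : a ≤ b) (hU : Continuous U) (hU0 : ∀ t, 0 ≤ U t)
    (hW : Continuous W) (hWρ : ∀ t, ‖W t‖ ≤ ρ) (h1 : ∫ t in a..b, U t = 1) {m : ℂ}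
    (hm : ∫ t in a..b, (U t : ℂ) * W t = m) :
    ∫ t in a..b, U t * ‖W t - m‖ ^ 2 ≤ ρ ^ 2 - ‖m‖ ^ 2 := by
  have hre : ∫ t in a..b, U t * (W t * star m).re = ‖m‖ ^ 2 := by
    have h2 : ∫ t in a..b, (U t : ℂ) * W t * star m = m * star m := by
      rw [integral_mul_const, hm]
    have cm : Continuous fun t => (U t : ℂ) * W t * star m := by fun_prop
    have h3 := Complex.reCLM.intervalIntegral_comp_comm
      (cm.intervalIntegrable (μ := MeasureTheory.volume) a b)
    simp only [Complex.reCLM_apply] at h3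
    rw [h2] at h3
    have h4 : (m * star m).re = ‖m‖ ^ 2 := by
      rw [Complex.star_def, Complex.mul_conj, Complex.ofReal_re, Complex.normSq_eq_norm_sq]
    rw [← h4, ← h3]
    congr 1
    ext t
    rw [mul_assoc, Complex.re_ofReal_mul]
  have key : ∀ t, U t * ‖W t - m‖ ^ 2 ≤
      U t * (ρ ^ 2 + ‖m‖ ^ 2) - 2 * (U t * (W t * star m).re) := by
    intro t
    have e : ‖W t - m‖ ^ 2 = ‖W t‖ ^ 2 + ‖m‖ ^ 2 - 2 * (W t * star m).re := by
      rw [← Complex.normSq_eq_norm_sq, Complex.normSq_sub, Complex.normSq_eq_norm_sq,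
        Complex.normSq_eq_norm_sq]
      rfl
    have h5 : ‖W t‖ ^ 2 ≤ ρ ^ 2 := pow_le_pow_left₀ (norm_nonneg _) (hWρ t) 2
    rw [e]
    nlinarith [mul_le_mul_of_nonneg_left h5 (hU0 t)]
  have c1 : Continuous fun t => U t * ‖W t - m‖ ^ 2 := by fun_prop
  have c2 : Continuous fun t => U t * (ρ ^ 2 + ‖m‖ ^ 2) := by fun_prop
  have c3 : Continuous fun t => 2 * (U t * (W t * star m).re) := by fun_prop
  have c23 : Continuous fun t =>
      U t * (ρ ^ 2 + ‖m‖ ^ 2) - 2 * (U t * (W t * star m).re) := c2.sub c3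
  refine (integral_mono_on hab (c1.intervalIntegrable _ _)
    (c23.intervalIntegrable _ _) fun t _ => key t).trans_eq ?_
  rw [integral_sub (c2.intervalIntegrable _ _) (c3.intervalIntegrable _ _), integral_mul_const,
    integral_const_mul, hre, h1]
  ring

/-- The quantity on the left is the integral of (W - m)^2, so the variance bounds it. -/
theorem norm_second_moment_sub_sq_le (hab : a ≤ b) (hU : Continuous U) (hU0 : ∀ t, 0 ≤ U t)
    (hW : Continuous W) (hWρ : ∀ t, ‖W t‖ ≤ ρ) (h1 : ∫ t in a..b, U t = 1) {m : ℂ}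
    (hm : ∫ t in a..b, (U t : ℂ) * W t = m) :
    ‖(∫ t in a..b, (U t : ℂ) * W t ^ 2) - m ^ 2‖ ≤ ρ ^ 2 - ‖m‖ ^ 2 := by
  refine le_trans ?_ (weighted_integral_norm_sub_sq_le hab hU hU0 hW hWρ h1 hm)
  refine le_trans (le_of_eq ?_) (norm_weighted_integral_le (V := fun t => (W t - m) ^ 2) hab hU hU0
    (by fun_prop) fun t => (norm_pow _ _).le)
  have h1c : ∫ t in a..b, (U t : ℂ) = 1 := by rw [integral_ofReal, h1, Complex.ofReal_one]
  have cU : Continuous fun t => (U t : ℂ) := by fun_prop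
  have c2 : Continuous fun t => (U t : ℂ) * W t ^ 2 := by fun_prop
  have c1 : Continuous fun t => (2 * m) * ((U t : ℂ) * W t) := by fun_prop
  have c21 : Continuous fun t => (U t : ℂ) * W t ^ 2 - (2 * m) * ((U t : ℂ) * W t) := c2.sub c1
  have c0 : Continuous fun t => m ^ 2 * (U t : ℂ) := by fun_prop
  have e : ∀ t, (U t : ℂ) * (W t - m) ^ 2 =
      (U t : ℂ) * W t ^ 2 - (2 * m) * ((U t : ℂ) * W t) + m ^ 2 * (U t : ℂ) := fun t => by ring
  simp_rw [e]
  rw [integral_add (c21.intervalIntegrable _ _) (c0.intervalIntegrable _ _),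
    integral_sub (c2.intervalIntegrable _ _) (c1.intervalIntegrable _ _), integral_const_mul,
    integral_const_mul, hm, h1c]
  congr 1
  ring

/-- Subtracting from w^3 its tangent line at m leaves (w - m)^2 (w + 2m). The linear term integrates
to zero because m is the mean, and |w + 2m| ≤ ρ + 2|m| leaves the variance. -/
theorem norm_third_moment_sub_cube_le (hab : a ≤ b) (hU : Continuous U) (hU0 : ∀ t, 0 ≤ U t)
    (hW : Continuous W) (hWρ : ∀ t, ‖W t‖ ≤ ρ) (h1 : ∫ t in a..b, U t = 1) {m : ℂ}
    (hm : ∫ t in a..b, (U t : ℂ) * W t = m) (hρ : 0 ≤ ρ) :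
    ‖(∫ t in a..b, (U t : ℂ) * W t ^ 3) - m ^ 3‖ ≤ (ρ + 2 * ‖m‖) * (ρ ^ 2 - ‖m‖ ^ 2) := by
  refine le_trans ?_ (mul_le_mul_of_nonneg_left
    (weighted_integral_norm_sub_sq_le hab hU hU0 hW hWρ h1 hm) (by positivity))
  rw [← integral_const_mul]
  have hb : ∀ t, ‖(W t - m) ^ 2 * (W t + 2 * m)‖ ≤ (ρ + 2 * ‖m‖) * ‖W t - m‖ ^ 2 := by
    intro t
    rw [norm_mul, norm_pow, mul_comm]
    refine mul_le_mul_of_nonneg_right ?_ (by positivity)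
    refine (norm_add_le _ _).trans ?_
    rw [norm_mul, Complex.norm_two]
    linarith [hWρ t]
  refine le_trans (le_of_eq ?_) ((norm_weighted_integral_le hab hU hU0
    (by fun_prop) hb).trans_eq ?_)
  · have h1c : ∫ t in a..b, (U t : ℂ) = 1 := by rw [integral_ofReal, h1, Complex.ofReal_one]
    have c2 : Continuous fun t => (U t : ℂ) * W t ^ 3 := by fun_prop
    have c1 : Continuous fun t => (3 * m ^ 2) * ((U t : ℂ) * W t) := by fun_prop
    have c21 : Continuous fun t => (U t : ℂ) * W t ^ 3 - (3 * m ^ 2) * ((U t : ℂ) * W t) := c2.sub c1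
    have c0 : Continuous fun t => (2 * m ^ 3) * (U t : ℂ) := by fun_prop
    have e : ∀ t, (U t : ℂ) * ((W t - m) ^ 2 * (W t + 2 * m)) =
        (U t : ℂ) * W t ^ 3 - (3 * m ^ 2) * ((U t : ℂ) * W t) + (2 * m ^ 3) * (U t : ℂ) :=
      fun t => by ring
    simp_rw [e]
    rw [integral_add (c21.intervalIntegrable _ _) (c0.intervalIntegrable _ _),
      integral_sub (c2.intervalIntegrable _ _) (c1.intervalIntegrable _ _), integral_const_mul,
      integral_const_mul, hm, h1c]
    congr 1
    ring
  · congr 1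
    ext t
    ring

end Moments

/-- The `n`-th Taylor coefficient of `f` at `0`. -/
noncomputable def taylorCoeff (f : ℂ → ℂ) (n : ℕ) : ℂ :=
  iteratedDeriv n f 0 / (n.factorial : ℂ)

/-! ### Coefficients of functions with nonnegative real part -/

section Caratheodory

open intervalIntegral Metric Filter Topology

variable {P : ℂ → ℂ} {r : ℝ}

theorem integral_circleMap_mul_inv_pow (hr : 0 < r) (hP : DifferentiableOn ℂ P (closedBall 0 r))
    (n : ℕ) :
    ∫ t in (0)..(2 * Real.pi), P (circleMap 0 r t) * (circleMap 0 r t)⁻¹ ^ n =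
      2 * Real.pi * taylorCoeff P n := by
  have h := hP.circleIntegral_one_div_sub_center_pow_smul hr n
  rw [circleIntegral] at h
  have e : ∀ t : ℝ, deriv (circleMap 0 r) t • (1 / (circleMap 0 r t - 0) ^ (n + 1)) •
      P (circleMap 0 r t) = Complex.I * (P (circleMap 0 r t) * (circleMap 0 r t)⁻¹ ^ n) := by
    intro t
    have h0 : circleMap 0 r t ≠ 0 := circleMap_ne_center hr.ne'
    simp only [deriv_circleMap, smul_eq_mul, sub_zero, inv_pow]
    field_simp
    ring
  simp_rw [e] at h
  rw [integral_const_mul] at h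
  refine mul_left_cancel₀ Complex.I_ne_zero (h.trans ?_)
  rw [taylorCoeff, smul_eq_mul]
  ring

/-- On the circle 1/z = conj(z)/r^2, so this is a multiple of the conjugate of the mean of P z^n,
which is the value of P z^n at 0. The factor `0 ^ n` leaves a contribution only for n = 0. -/
theorem integral_conj_circleMap_mul_inv_pow (hr : 0 < r)
    (hP : DifferentiableOn ℂ P (closedBall 0 r)) (n : ℕ) :
    ∫ t in (0)..(2 * Real.pi), star (P (circleMap 0 r t)) * (circleMap 0 r t)⁻¹ ^ n =
      2 * Real.pi * star (P 0 * 0 ^ n) := by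
  have hd : DifferentiableOn ℂ (fun z => P z * z ^ n) (closedBall 0 r) :=
    hP.mul (differentiableOn_id.pow n)
  have h := integral_circleMap_mul_inv_pow hr hd 0
  simp only [pow_zero, mul_one, taylorCoeff, iteratedDeriv_zero, Nat.factorial_zero, Nat.cast_one,
    div_one] at h
  have e : ∀ t : ℝ, star (P (circleMap 0 r t)) * (circleMap 0 r t)⁻¹ ^ n =
      ((r : ℂ) ^ 2)⁻¹ ^ n * star (P (circleMap 0 r t) * circleMap 0 r t ^ n) := by
    intro t
    have h0 : circleMap 0 r t ≠ 0 := circleMap_ne_center hr.ne'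
    have hr0 : (r : ℂ) ≠ 0 := by exact_mod_cast hr.ne'
    have h1 : star (circleMap 0 r t) * circleMap 0 r t = (r : ℂ) ^ 2 := by
      rw [mul_comm, Complex.star_def, Complex.mul_conj, Complex.normSq_eq_norm_sq,
        norm_circleMap_zero, sq_abs]
      push_cast; rfl
    have h2 : (circleMap 0 r t)⁻¹ = ((r : ℂ) ^ 2)⁻¹ * star (circleMap 0 r t) := by
      rw [← h1]
      have : star (circleMap 0 r t) ≠ 0 := star_ne_zero.mpr h0
      field_simp
    rw [h2, star_mul', star_pow, mul_pow]
    ring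
  have h3 : ∫ t in (0)..(2 * Real.pi), star (P (circleMap 0 r t) * circleMap 0 r t ^ n) =
      star (∫ t in (0)..(2 * Real.pi), P (circleMap 0 r t) * circleMap 0 r t ^ n) := by
    rw [integral_of_le Real.two_pi_pos.le, integral_of_le Real.two_pi_pos.le]
    exact integral_conj
  simp_rw [e]
  rw [integral_const_mul, h3, h]
  rcases Nat.eq_zero_or_pos n with rfl | hn
  · simp
  · simp [hn.ne']

/-- The Taylor coefficients of a function of positive real part are moments of its real part on
circles. -/
theorem integral_re_circleMap_mul_inv_pow (hr : 0 < r)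
    (hP : DifferentiableOn ℂ P (closedBall 0 r)) (n : ℕ) :
    ∫ t in (0)..(2 * Real.pi), (((P (circleMap 0 r t)).re / Real.pi : ℝ) : ℂ) *
      (circleMap 0 r t)⁻¹ ^ n = taylorCoeff P n + star (P 0 * 0 ^ n) := by
  have cP : Continuous fun t => P (circleMap 0 r t) :=
    hP.continuousOn.comp_continuous (continuous_circleMap 0 r)
      fun t => circleMap_mem_closedBall 0 hr.le t
  have ci : Continuous fun t => (circleMap 0 r t)⁻¹ :=
    (continuous_circleMap 0 r).inv₀ fun t => circleMap_ne_center hr.ne'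
  have hpi : (Real.pi : ℂ) ≠ 0 := by exact_mod_cast Real.pi_ne_zero
  have e : ∀ t : ℝ, (((P (circleMap 0 r t)).re / Real.pi : ℝ) : ℂ) * (circleMap 0 r t)⁻¹ ^ n =
      (2 * Real.pi : ℂ)⁻¹ * (P (circleMap 0 r t) * (circleMap 0 r t)⁻¹ ^ n +
        star (P (circleMap 0 r t)) * (circleMap 0 r t)⁻¹ ^ n) := by
    intro t
    rw [Complex.ofReal_div, Complex.re_eq_add_conj, Complex.star_def]
    field_simp
  simp_rw [e]
  have c1 : Continuous fun t => P (circleMap 0 r t) * (circleMap 0 r t)⁻¹ ^ n :=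
    cP.mul (ci.pow n)
  have c2 : Continuous fun t => star (P (circleMap 0 r t)) * (circleMap 0 r t)⁻¹ ^ n :=
    cP.star.mul (ci.pow n)
  rw [integral_const_mul, integral_add (c1.intervalIntegrable _ _) (c2.intervalIntegrable _ _),
    integral_circleMap_mul_inv_pow hr hP, integral_conj_circleMap_mul_inv_pow hr hP]
  field_simp

/-- Coefficient inequalities on a circle of radius `r < 1` for `P` with nonnegative real part and
`P 0 = 1 / 2`. -/
theorem coeff_bounds_of_re_nonneg_of_lt (hr : 0 < r) (hP : DifferentiableOn ℂ P (closedBall 0 r))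
    (hP0 : P 0 = 1 / 2) (hre : ∀ z ∈ closedBall (0 : ℂ) r, 0 ≤ (P z).re) :
    (∀ n ≠ 0, ‖taylorCoeff P n‖ ≤ r⁻¹ ^ n) ∧
    ‖taylorCoeff P 2 - taylorCoeff P 1 ^ 2‖ ≤ r⁻¹ ^ 2 - ‖taylorCoeff P 1‖ ^ 2 ∧
    ‖taylorCoeff P 3 - taylorCoeff P 1 ^ 3‖ ≤
      (r⁻¹ + 2 * ‖taylorCoeff P 1‖) * (r⁻¹ ^ 2 - ‖taylorCoeff P 1‖ ^ 2) := by
  have cP : Continuous fun t => P (circleMap 0 r t) :=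
    hP.continuousOn.comp_continuous (continuous_circleMap 0 r)
      fun t => circleMap_mem_closedBall 0 hr.le t
  have hW : Continuous fun t => (circleMap 0 r t)⁻¹ :=
    (continuous_circleMap 0 r).inv₀ fun t => circleMap_ne_center hr.ne'
  have hU : Continuous fun t => (P (circleMap 0 r t)).re / Real.pi :=
    (Complex.continuous_re.comp cP).div_const _
  have hU0 : ∀ t, 0 ≤ (P (circleMap 0 r t)).re / Real.pi := fun t =>
    div_nonneg (hre _ (circleMap_mem_closedBall 0 hr.le t)) Real.pi_pos.le
  have hWρ : ∀ t, ‖(circleMap 0 r t)⁻¹‖ ≤ r⁻¹ := fun t => by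
    rw [norm_inv, norm_circleMap_zero, abs_of_pos hr]
  have hmom := integral_re_circleMap_mul_inv_pow hr hP
  -- The zeroth moment is P(0) + conj P(0); the normalization P(0) = 1/2 makes it 1.
  have h1 : ∫ t in (0)..(2 * Real.pi), (P (circleMap 0 r t)).re / Real.pi = 1 := by
    have h := hmom 0
    simp only [pow_zero, mul_one, taylorCoeff, iteratedDeriv_zero, hP0] at h
    rw [integral_ofReal] at h
    have h' : (1 / 2 / (Nat.factorial 0 : ℂ) + star (1 / 2 : ℂ)) = ((1 : ℝ) : ℂ) := by
      have : star (1 / 2 : ℂ) = 1 / 2 := by simp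
      rw [this]; norm_num
    rw [h'] at h
    exact_mod_cast h
  have hq : ∀ n ≠ 0, ∫ t in (0)..(2 * Real.pi), (((P (circleMap 0 r t)).re / Real.pi : ℝ) : ℂ) *
      (circleMap 0 r t)⁻¹ ^ n = taylorCoeff P n := fun n hn => by
    rw [hmom n]; simp [hn]
  have hm := hq 1 one_ne_zero
  simp only [pow_one] at hm
  refine ⟨fun n hn => ?_, ?_, ?_⟩
  · rw [← hq n hn]
    exact norm_moment_le Real.two_pi_pos.le hU hU0 hWρ h1 n
  · rw [← hq 2 two_ne_zero]
    exact norm_second_moment_sub_sq_le Real.two_pi_pos.le hU hU0 hW hWρ h1 hm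
  · rw [← hq 3 three_ne_zero]
    exact norm_third_moment_sub_cube_le Real.two_pi_pos.le hU hU0 hW hWρ h1 hm (inv_pos.2 hr).le

/-- Carathéodory's coefficient inequality, and two refinements, for `P` with nonnegative real part
in the unit disk and `P 0 = 1 / 2`. -/
theorem coeff_bounds_of_re_nonneg (hP : DifferentiableOn ℂ P (ball 0 1))
    (hP0 : P 0 = 1 / 2) (hre : ∀ z ∈ ball (0 : ℂ) 1, 0 ≤ (P z).re) :
    (∀ n ≠ 0, ‖taylorCoeff P n‖ ≤ 1) ∧
    ‖taylorCoeff P 2 - taylorCoeff P 1 ^ 2‖ ≤ 1 - ‖taylorCoeff P 1‖ ^ 2 ∧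
    ‖taylorCoeff P 3 - taylorCoeff P 1 ^ 3‖ ≤
      (1 + 2 * ‖taylorCoeff P 1‖) * (1 - ‖taylorCoeff P 1‖ ^ 2) := by
  -- The coefficients do not depend on r, so the inequalities pass to the limit as r tends to 1 from
  -- below.
  have key : ∀ᶠ r in 𝓝[<] (1 : ℝ), (∀ n ≠ 0, ‖taylorCoeff P n‖ ≤ r⁻¹ ^ n) ∧
      ‖taylorCoeff P 2 - taylorCoeff P 1 ^ 2‖ ≤ r⁻¹ ^ 2 - ‖taylorCoeff P 1‖ ^ 2 ∧
      ‖taylorCoeff P 3 - taylorCoeff P 1 ^ 3‖ ≤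
        (r⁻¹ + 2 * ‖taylorCoeff P 1‖) * (r⁻¹ ^ 2 - ‖taylorCoeff P 1‖ ^ 2) := by
    filter_upwards [Ioo_mem_nhdsLT (zero_lt_one' ℝ)] with r hr
    have hsub : closedBall (0 : ℂ) r ⊆ ball 0 1 := closedBall_subset_ball hr.2
    exact coeff_bounds_of_re_nonneg_of_lt hr.1 (hP.mono hsub) hP0 fun z hz => hre z (hsub hz)
  have hinv : Tendsto (fun r : ℝ => r⁻¹) (𝓝[<] 1) (𝓝 1) := by
    have := (continuousAt_inv₀ (one_ne_zero' ℝ)).tendsto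
    rw [inv_one] at this
    exact this.mono_left nhdsWithin_le_nhds
  refine ⟨fun n hn => ?_, ?_, ?_⟩
  · refine ge_of_tendsto (x := 𝓝[<] (1 : ℝ)) (by simpa using hinv.pow n)
      (key.mono fun r h => h.1 n hn)
  · refine ge_of_tendsto (x := 𝓝[<] (1 : ℝ)) ?_ (key.mono fun r h => h.2.1)
    simpa using (hinv.pow 2).sub_const (‖taylorCoeff P 1‖ ^ 2)
  · refine ge_of_tendsto (x := 𝓝[<] (1 : ℝ)) ?_ (key.mono fun r h => h.2.2)
    simpa using (hinv.add_const (2 * ‖taylorCoeff P 1‖)).mul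
      ((hinv.pow 2).sub_const (‖taylorCoeff P 1‖ ^ 2))

end Caratheodory

/-! ### Calculus of Taylor coefficients -/

section TaylorCoeff

open Filter Topology

variable {f g : ℂ → ℂ}

theorem taylorCoeff_congr (h : f =ᶠ[𝓝 0] g) (n : ℕ) : taylorCoeff f n = taylorCoeff g n := by
  rw [taylorCoeff, taylorCoeff, h.iteratedDeriv_eq]

theorem taylorCoeff_zero (f : ℂ → ℂ) : taylorCoeff f 0 = f 0 := by
  simp [taylorCoeff]

theorem taylorCoeff_add (hf : AnalyticAt ℂ f 0) (hg : AnalyticAt ℂ g 0) (n : ℕ) :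
    taylorCoeff (fun z => f z + g z) n = taylorCoeff f n + taylorCoeff g n := by
  rw [taylorCoeff, iteratedDeriv_fun_add hf.contDiffAt hg.contDiffAt, add_div]
  rfl

theorem taylorCoeff_const_mul (a : ℂ) (f : ℂ → ℂ) (n : ℕ) :
    taylorCoeff (fun z => a * f z) n = a * taylorCoeff f n := by
  rw [taylorCoeff, iteratedDeriv_const_mul_field, mul_div_assoc]
  rfl

theorem taylorCoeff_const_of_ne_zero (a : ℂ) {n : ℕ} (hn : n ≠ 0) :
    taylorCoeff (fun _ => a) n = 0 := by
  simp [taylorCoeff, iteratedDeriv_const, hn]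

/-- Cauchy product formula. -/
theorem taylorCoeff_mul (hf : AnalyticAt ℂ f 0) (hg : AnalyticAt ℂ g 0) (n : ℕ) :
    taylorCoeff (fun z => f z * g z) n =
      ∑ i ∈ Finset.range (n + 1), taylorCoeff f i * taylorCoeff g (n - i) := by
  rw [taylorCoeff, iteratedDeriv_fun_mul hf.contDiffAt hg.contDiffAt, Finset.sum_div]
  refine Finset.sum_congr rfl fun i hi => ?_
  have hin : i ≤ n := Nat.lt_succ_iff.1 (Finset.mem_range.1 hi)
  rw [Nat.cast_choose ℂ hin, taylorCoeff, taylorCoeff]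
  have h1 : (n.factorial : ℂ) ≠ 0 := by exact_mod_cast n.factorial_ne_zero
  have h2 : (i.factorial : ℂ) ≠ 0 := by exact_mod_cast i.factorial_ne_zero
  have h3 : ((n - i).factorial : ℂ) ≠ 0 := by exact_mod_cast (n - i).factorial_ne_zero
  field_simp

theorem taylorCoeff_id_mul_succ (hf : AnalyticAt ℂ f 0) (n : ℕ) :
    taylorCoeff (fun z => z * f z) (n + 1) = taylorCoeff f n := by
  rw [taylorCoeff_mul (f := fun z => z) analyticAt_id hf, Finset.sum_eq_single 1]
  · simp [taylorCoeff, iteratedDeriv_one]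
  · rintro (_ | _ | i) _ hi
    · simp [taylorCoeff]
    · exact absurd rfl hi
    · have : taylorCoeff (fun z : ℂ => z) (i + 1 + 1) = 0 := by
        rw [taylorCoeff, iteratedDeriv_succ', iteratedDeriv_succ']
        simp
      rw [this, zero_mul]
  · intro h
    exact absurd (Finset.mem_range.2 (by omega)) h

theorem taylorCoeff_deriv (f : ℂ → ℂ) (n : ℕ) :
    taylorCoeff (deriv f) n = (n + 1) * taylorCoeff f (n + 1) := by
  rw [taylorCoeff, taylorCoeff, iteratedDeriv_succ', Nat.factorial_succ]
  have h1 : (n.factorial : ℂ) ≠ 0 := by exact_mod_cast n.factorial_ne_zero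
  have h2 : (n : ℂ) + 1 ≠ 0 := by exact_mod_cast n.succ_ne_zero
  push_cast
  field_simp

theorem taylorCoeff_id_mul_deriv (hf : AnalyticAt ℂ f 0) (n : ℕ) :
    taylorCoeff (fun z => z * deriv f z) n = n * taylorCoeff f n := by
  cases n with
  | zero => simp [taylorCoeff]
  | succ n => rw [taylorCoeff_id_mul_succ hf.deriv, taylorCoeff_deriv]; push_cast; rfl

end TaylorCoeff

/-! ### The Riccati equation and the logarithmic coefficients -/

section LogCoeff

open Filter Topology

variable {f S : ℂ → ℂ}

theorem IsNormalizedAnalytic.analyticAt (hf : IsNormalizedAnalytic f) : AnalyticAt ℂ f 0 :=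
  hf.differentiableOn.analyticAt (Metric.ball_mem_nhds _ one_pos)

theorem IsNormalizedAnalytic.dslope_zero (hf : IsNormalizedAnalytic f) : dslope f 0 0 = 1 := by
  rw [dslope_same, hf.deriv_zero]

theorem IsNormalizedAnalytic.analyticAt_dslope (hf : IsNormalizedAnalytic f) :
    AnalyticAt ℂ (dslope f 0) 0 :=
  ((Complex.differentiableOn_dslope (Metric.ball_mem_nhds _ one_pos)).2
    hf.differentiableOn).analyticAt (Metric.ball_mem_nhds _ one_pos)

theorem IsNormalizedAnalytic.analyticAt_log_dslope (hf : IsNormalizedAnalytic f) :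
    AnalyticAt ℂ (fun z => Complex.log (dslope f 0 z)) 0 :=
  hf.analyticAt_dslope.clog (by rw [hf.dslope_zero]; exact Complex.one_mem_slitPlane)

theorem IsNormalizedAnalytic.eventuallyEq_mul_exp_log (hf : IsNormalizedAnalytic f) :
    f =ᶠ[𝓝 0] fun z => z * Complex.exp (Complex.log (dslope f 0 z)) := by
  have h0 : ∀ᶠ z in 𝓝 (0 : ℂ), dslope f 0 z ≠ 0 :=
    hf.analyticAt_dslope.continuousAt.eventually_ne (by rw [hf.dslope_zero]; exact one_ne_zero)
  filter_upwards [h0] with z hz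
  rw [Complex.exp_log hz]
  have := sub_smul_dslope f 0 z
  rw [sub_zero, hf.map_zero, sub_zero, smul_eq_mul] at this
  exact this.symm

/-- The Riccati equation linking `G = z f' / f - 1` and `S = z f'' / f'`, written with an analytic
branch `L` of `log (f z / z)`, so that `G = z L'`. -/
theorem riccati_of_eq_mul_exp {L : ℂ → ℂ} (hL : AnalyticAt ℂ L 0)
    (hfL : f =ᶠ[𝓝 0] fun z => z * Complex.exp (L z))
    (hS : ∀ᶠ z in 𝓝 0, S z * deriv f z = z * deriv (deriv f) z) :
    ∀ᶠ z in 𝓝 (0 : ℂ), S z * (1 + z * deriv L z) =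
      z * deriv (fun z => z * deriv L z) z + z * deriv L z +
        (z * deriv L z) * (z * deriv L z) := by
  have h1 : deriv f =ᶠ[𝓝 0] fun z => Complex.exp (L z) * (1 + z * deriv L z) := by
    filter_upwards [hfL.deriv, hL.eventually_analyticAt] with z hz hz2
    rw [hz]
    have := (hasDerivAt_id z).mul hz2.differentiableAt.hasDerivAt.cexp
    refine (this.deriv).trans ?_
    simp only [id]
    ring
  have h2 : deriv (deriv f) =ᶠ[𝓝 0] fun z => Complex.exp (L z) *
      (deriv L z * (1 + z * deriv L z) + deriv (fun z => z * deriv L z) z) := by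
    filter_upwards [h1.deriv, hL.eventually_analyticAt] with z hz hz2
    rw [hz]
    have hG : DifferentiableAt ℂ (fun z => z * deriv L z) z :=
      differentiableAt_id.mul hz2.deriv.differentiableAt
    have := hz2.differentiableAt.hasDerivAt.cexp.mul (hG.hasDerivAt.const_add 1)
    refine (this.deriv).trans ?_
    ring
  filter_upwards [h1, h2, hS] with z e1 e2 e3
  rw [e1, e2] at e3
  refine mul_left_cancel₀ (Complex.exp_ne_zero (L z)) ?_
  linear_combination e3

/-- The recurrence for the logarithmic coefficients in terms of the Taylor coefficients of
`z f'' / f'`. -/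
theorem IsNormalizedAnalytic.logCoeff_recurrence (hf : IsNormalizedAnalytic f)
    (hSa : AnalyticAt ℂ S 0) (hS : ∀ᶠ z in 𝓝 0, S z * deriv f z = z * deriv (deriv f) z) (n : ℕ) :
    taylorCoeff S n + ∑ i ∈ Finset.range (n + 1),
        taylorCoeff S i * (2 * (n - i : ℕ) * logCoeff f (n - i)) =
      2 * n * (n + 1) * logCoeff f n + ∑ i ∈ Finset.range (n + 1),
        (2 * i * logCoeff f i) * (2 * (n - i : ℕ) * logCoeff f (n - i)) := by
  set L : ℂ → ℂ := fun z => Complex.log (dslope f 0 z) with hLdef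
  have hL : AnalyticAt ℂ L 0 := hf.analyticAt_log_dslope
  have hG : AnalyticAt ℂ (fun z => z * deriv L z) 0 := analyticAt_id.mul hL.deriv
  have hl : ∀ k, taylorCoeff L k = 2 * logCoeff f k := fun k => by
    rw [logCoeff, taylorCoeff]; ring
  have hg : ∀ k, taylorCoeff (fun z => z * deriv L z) k = 2 * k * logCoeff f k := fun k => by
    rw [taylorCoeff_id_mul_deriv hL, hl]; ring
  have hR := riccati_of_eq_mul_exp hL hf.eventuallyEq_mul_exp_log hS
  have e : (fun z => S z + S z * (z * deriv L z)) =ᶠ[𝓝 0] fun z =>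
      z * deriv (fun z => z * deriv L z) z + z * deriv L z +
        (z * deriv L z) * (z * deriv L z) := by
    filter_upwards [hR] with z hz
    rw [← hz]; ring
  have h := taylorCoeff_congr e n
  have hzG : AnalyticAt ℂ (fun z => z * deriv (fun z => z * deriv L z) z) 0 :=
    analyticAt_id.mul hG.deriv
  rw [taylorCoeff_add hSa (hSa.fun_mul hG), taylorCoeff_mul hSa hG,
    taylorCoeff_add (hzG.fun_add hG) (hG.fun_mul hG), taylorCoeff_add hzG hG, taylorCoeff_mul hG hG,
    taylorCoeff_id_mul_deriv hG] at h
  simp only [hg] at h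
  rw [h]
  ring

/-- The first five logarithmic coefficients in terms of the Taylor coefficients of
`z f'' / f'`. -/
theorem IsNormalizedAnalytic.logCoeff_formulas (hf : IsNormalizedAnalytic f)
    (hSa : AnalyticAt ℂ S 0) (hS : ∀ᶠ z in 𝓝 0, S z * deriv f z = z * deriv (deriv f) z)
    (hS0 : S 0 = 0) {c : ℂ} {q : ℕ → ℂ} (hq : ∀ n, taylorCoeff S n = c * q n) :
    logCoeff f 1 = c / 4 * q 1 ∧
    logCoeff f 2 = c / 12 * (q 2 + c / 4 * q 1 ^ 2) ∧
    logCoeff f 3 = c / 24 * (q 3 + c / 2 * q 1 * q 2) ∧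
    logCoeff f 4 = c / 40 * (q 4 + 2 * c / 9 * q 2 ^ 2 +
      c / 2 * q 1 * (q 3 + c / 18 * q 1 * (q 2 - c / 4 * q 1 ^ 2))) ∧
    logCoeff f 5 = c / 60 * (q 5 + c / 2 * q 1 * q 4 + c ^ 2 / 24 * q 1 ^ 2 * q 3 +
      5 * c / 12 * q 2 * (q 3 + c / 10 * q 1 * (q 2 - c / 2 * q 1 ^ 2))) := by
  have h0 : c * q 0 = 0 := by rw [← hq, taylorCoeff_zero, hS0]
  have hr := fun n => hf.logCoeff_recurrence hSa hS n
  simp only [hq] at hr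
  have r1 := hr 1
  have r2 := hr 2
  have r3 := hr 3
  have r4 := hr 4
  have r5 := hr 5
  simp only [Finset.sum_range_succ, Finset.sum_range_zero, h0] at r1 r2 r3 r4 r5
  norm_num at r1 r2 r3 r4 r5
  -- In the n-th relation γ_n survives only with the factor 2n(n + 1) = 4, 12, 24, 40, 60: its other
  -- occurrences are multiplied by S(0) = 0 or by the index 0.
  have g1 : logCoeff f 1 = c / 4 * q 1 := by linear_combination (-1 / 4) * r1
  rw [g1] at r2 r3 r4 r5
  have g2 : logCoeff f 2 = c / 12 * (q 2 + c / 4 * q 1 ^ 2) := by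
    linear_combination (-1 / 12) * r2
  rw [g2] at r3 r4 r5
  have g3 : logCoeff f 3 = c / 24 * (q 3 + c / 2 * q 1 * q 2) := by
    linear_combination (-1 / 24) * r3
  rw [g3] at r4 r5
  have g4 : logCoeff f 4 = c / 40 * (q 4 + 2 * c / 9 * q 2 ^ 2 +
      c / 2 * q 1 * (q 3 + c / 18 * q 1 * (q 2 - c / 4 * q 1 ^ 2))) := by
    linear_combination (-1 / 40) * r4
  rw [g4] at r5
  exact ⟨g1, g2, g3, g4, by linear_combination (-1 / 60) * r5⟩

end LogCoeff

/-! ### Estimates of the coefficient polynomials -/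

section Bounds

theorem norm_add_ofReal_mul_le {x y : ℂ} {t X Y : ℝ} (ht : 0 ≤ t) (hx : ‖x‖ ≤ X) (hy : ‖y‖ ≤ Y) :
    ‖x + (t : ℂ) * y‖ ≤ X + t * Y := by
  refine (norm_add_le _ _).trans (add_le_add hx ?_)
  rw [norm_mul, Complex.norm_real, Real.norm_of_nonneg ht]
  exact mul_le_mul_of_nonneg_left hy ht

variable {c : ℝ} {q₁ q₂ q₃ q₄ q₅ : ℂ}

theorem norm_sub_ofReal_mul_sq_le (h : ‖q₂ - q₁ ^ 2‖ ≤ 1 - ‖q₁‖ ^ 2) {t : ℝ} (ht : t ≤ 1) :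
    ‖q₂ - (t : ℂ) * q₁ ^ 2‖ ≤ 1 - t * ‖q₁‖ ^ 2 := by
  have e : q₂ - (t : ℂ) * q₁ ^ 2 = (q₂ - q₁ ^ 2) + ((1 - t : ℝ) : ℂ) * q₁ ^ 2 := by
    push_cast; ring
  rw [e]
  refine (norm_add_ofReal_mul_le (sub_nonneg.2 ht) h (norm_pow _ _).le).trans_eq ?_
  ring

/-- Only the term with -c/4 needs more than |q_n| ≤ 1; as c/4 ≤ 1, `norm_sub_ofReal_mul_sq_le`
bounds it by 1 - (c/4)a^2. -/
theorem norm_fourth_le (hc0 : 0 ≤ c) (hc3 : c ≤ 3) (h1 : ‖q₁‖ ≤ 1) (h2 : ‖q₂‖ ≤ 1) (h3 : ‖q₃‖ ≤ 1)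
    (h4 : ‖q₄‖ ≤ 1) (h12 : ‖q₂ - q₁ ^ 2‖ ≤ 1 - ‖q₁‖ ^ 2) :
    ‖q₄ + ((2 * c / 9 : ℝ) : ℂ) * q₂ ^ 2 + ((c / 2 : ℝ) : ℂ) *
      (q₁ * (q₃ + ((c / 18 : ℝ) : ℂ) * (q₁ * (q₂ - ((c / 4 : ℝ) : ℂ) * q₁ ^ 2))))‖ ≤
    1 + 2 * c / 9 + c / 2 * (1 + c / 18 - c ^ 2 / 72) := by
  set a := ‖q₁‖ with ha
  have ha0 : 0 ≤ a := norm_nonneg _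
  have b1 : ‖q₁ * (q₂ - ((c / 4 : ℝ) : ℂ) * q₁ ^ 2)‖ ≤ a * (1 - c / 4 * a ^ 2) := by
    rw [norm_mul]
    exact mul_le_mul_of_nonneg_left (norm_sub_ofReal_mul_sq_le h12 (by linarith)) ha0
  have b2 := norm_add_ofReal_mul_le (t := c / 18) (by positivity) h3 b1
  have b3 : ‖q₁ * (q₃ + ((c / 18 : ℝ) : ℂ) * (q₁ * (q₂ - ((c / 4 : ℝ) : ℂ) * q₁ ^ 2)))‖ ≤
      1 + c / 18 - c ^ 2 / 72 := by
    rw [norm_mul]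
    refine (mul_le_mul_of_nonneg_left b2 ha0).trans ?_
    -- The value at a = 1 minus the value at a, with the factor 1 - a extracted.
    have p1 : 0 ≤ (1 - a) * (1 + c / 18 * (1 + a) - c ^ 2 / 72 * ((1 + a) * (1 + a ^ 2))) := by
      refine mul_nonneg (by linarith) ?_
      have : c ^ 2 ≤ 9 := by nlinarith
      have h4 : (1 + a) * (1 + a ^ 2) ≤ 4 := by nlinarith
      have h5 : 0 ≤ (1 + a) * (1 + a ^ 2) := by positivity
      have h6 : 0 ≤ c / 18 * (1 + a) := by positivity
      nlinarith [mul_le_mul this h4 h5 (by norm_num)]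
    nlinarith [p1]
  have b4 : ‖q₂ ^ 2‖ ≤ 1 := by rw [norm_pow]; exact pow_le_one₀ (norm_nonneg _) h2
  refine (norm_add_ofReal_mul_le (by positivity) (norm_add_ofReal_mul_le (by positivity) h4 b4)
    b3).trans_eq ?_
  ring

/-- The two terms vanishing at |q_1| = 1 are the slack that `norm_fifth_le` can afford. -/
theorem norm_third_sub_le (hc0 : 0 ≤ c) (hc3 : c ≤ 3) (h1 : ‖q₁‖ ≤ 1) (h3 : ‖q₃‖ ≤ 1)
    (h12 : ‖q₂ - q₁ ^ 2‖ ≤ 1 - ‖q₁‖ ^ 2)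
    (h13 : ‖q₃ - q₁ ^ 3‖ ≤ (1 + 2 * ‖q₁‖) * (1 - ‖q₁‖ ^ 2)) :
    ‖q₃ + ((c / 10 : ℝ) : ℂ) * (q₁ * (q₂ - ((c / 2 : ℝ) : ℂ) * q₁ ^ 2))‖ ≤
      1 + c / 10 - c ^ 2 / 20 + 6 / 5 * (1 - ‖q₁‖) + c / 10 * (1 - ‖q₁‖ ^ 2) := by
  set a := ‖q₁‖ with ha
  have ha0 : 0 ≤ a := norm_nonneg _
  have c9 : c ^ 2 ≤ 9 := by nlinarith
  have g1 : (1 + a) * a ≤ 2 := by nlinarith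
  rcases le_total c 2 with hc2 | hc2
  · have b1 : ‖q₁ * (q₂ - ((c / 2 : ℝ) : ℂ) * q₁ ^ 2)‖ ≤ a * (1 - c / 2 * a ^ 2) := by
      rw [norm_mul]
      exact mul_le_mul_of_nonneg_left (norm_sub_ofReal_mul_sq_le h12 (by linarith)) ha0
    refine (norm_add_ofReal_mul_le (by positivity) h3 b1).trans ?_
    have p1 : 0 ≤ (1 - a) * (6 / 5 + c / 10 * (2 + a) - c ^ 2 / 20 * (1 + a * (1 + a))) := by
      refine mul_nonneg (by linarith) ?_
      have : c ^ 2 ≤ 4 := by nlinarith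
      have h6 : 0 ≤ c / 10 * (2 + a) := by positivity
      have h5 : 0 ≤ 1 + a * (1 + a) := by positivity
      have h4 : 1 + a * (1 + a) ≤ 3 := by linarith
      nlinarith [mul_le_mul this h4 h5 (by norm_num)]
    nlinarith [p1]
  -- Here c/2 ≥ 1, so the excess -s q_1^3 is rewritten as s(q_3 - q_1^3) - s q_3: part of q_3 is
  -- traded for the third-moment inequality.
  · set s : ℝ := c / 10 * (c / 2 - 1) with hs
    have hs0 : 0 ≤ s := mul_nonneg (by positivity) (by linarith)
    have hs1 : s ≤ 3 / 20 := by nlinarith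
    have e : q₃ + ((c / 10 : ℝ) : ℂ) * (q₁ * (q₂ - ((c / 2 : ℝ) : ℂ) * q₁ ^ 2)) =
        ((1 - s : ℝ) : ℂ) * q₃ + (s : ℂ) * (q₃ - q₁ ^ 3) +
          ((c / 10 : ℝ) : ℂ) * (q₁ * (q₂ - q₁ ^ 2)) := by
      rw [hs]; push_cast; ring
    have b0 : ‖((1 - s : ℝ) : ℂ) * q₃‖ ≤ 1 - s := by
      rw [norm_mul, Complex.norm_real, Real.norm_of_nonneg (by linarith)]
      exact mul_le_of_le_one_right (by linarith) h3
    have b1 : ‖q₁ * (q₂ - q₁ ^ 2)‖ ≤ a * (1 - a ^ 2) := by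
      rw [norm_mul]; exact mul_le_mul_of_nonneg_left h12 ha0
    rw [e]
    refine (norm_add_ofReal_mul_le (by positivity) (norm_add_ofReal_mul_le hs0 b0 h13) b1).trans ?_
    have p1 : 0 ≤ (1 - a) * (6 / 5 + c / 10 * (1 - a ^ 2) - s * ((1 + 2 * a) * (1 + a))) := by
      refine mul_nonneg (by linarith) ?_
      have h4 : (1 + 2 * a) * (1 + a) ≤ 6 := by nlinarith
      have h5 : 0 ≤ (1 + 2 * a) * (1 + a) := by positivity
      have h6 : 0 ≤ c / 10 * (1 - a ^ 2) := mul_nonneg (by positivity) (by nlinarith)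
      nlinarith [mul_le_mul hs1 h4 h5 (by norm_num)]
    have hs' : 1 + c / 10 - c ^ 2 / 20 = 1 - s := by rw [hs]; ring
    rw [hs']
    nlinarith [p1]

/-- Keeping |q_1| and |q_1|^2 in the second and third terms saves (c/2)(1 - a) and (c^2/24)(1 -
a^2). These equal 5c/12 times the slacks (6/5)(1 - a) and (c/10)(1 - a^2), so everything cancels. -/
theorem norm_fifth_le (hc0 : 0 ≤ c) (hc3 : c ≤ 3) (h1 : ‖q₁‖ ≤ 1) (h2 : ‖q₂‖ ≤ 1) (h3 : ‖q₃‖ ≤ 1)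
    (h4 : ‖q₄‖ ≤ 1) (h5 : ‖q₅‖ ≤ 1) (h12 : ‖q₂ - q₁ ^ 2‖ ≤ 1 - ‖q₁‖ ^ 2)
    (h13 : ‖q₃ - q₁ ^ 3‖ ≤ (1 + 2 * ‖q₁‖) * (1 - ‖q₁‖ ^ 2)) :
    ‖q₅ + ((c / 2 : ℝ) : ℂ) * (q₁ * q₄) + ((c ^ 2 / 24 : ℝ) : ℂ) * (q₁ ^ 2 * q₃) +
      ((5 * c / 12 : ℝ) : ℂ) * (q₂ * (q₃ + ((c / 10 : ℝ) : ℂ) *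
        (q₁ * (q₂ - ((c / 2 : ℝ) : ℂ) * q₁ ^ 2))))‖ ≤
    1 + c / 2 + c ^ 2 / 24 + 5 * c / 12 * (1 + c / 10 - c ^ 2 / 20) := by
  have b1 : ‖q₁ * q₄‖ ≤ ‖q₁‖ := by
    rw [norm_mul]; exact mul_le_of_le_one_right (norm_nonneg _) h4
  have b2 : ‖q₁ ^ 2 * q₃‖ ≤ ‖q₁‖ ^ 2 := by
    rw [norm_mul, norm_pow]; exact mul_le_of_le_one_right (by positivity) h3
  have b3 : ‖q₂ * (q₃ + ((c / 10 : ℝ) : ℂ) * (q₁ * (q₂ - ((c / 2 : ℝ) : ℂ) * q₁ ^ 2)))‖ ≤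
      1 + c / 10 - c ^ 2 / 20 + 6 / 5 * (1 - ‖q₁‖) + c / 10 * (1 - ‖q₁‖ ^ 2) := by
    rw [norm_mul]
    exact (mul_le_of_le_one_left (norm_nonneg _) h2).trans
      (norm_third_sub_le hc0 hc3 h1 h3 h12 h13)
  refine (norm_add_ofReal_mul_le (by positivity) (norm_add_ofReal_mul_le (by positivity)
    (norm_add_ofReal_mul_le (by positivity) h5 b1) b2) b3).trans_eq ?_
  ring

theorem le_mul_sqrt_of_sq_le {k x y : ℝ} (hk : 0 < k) (h : (x / k) ^ 2 ≤ y) :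
    x ≤ k * Real.sqrt y := by
  have := Real.le_sqrt_of_sq_le h
  rwa [div_le_iff₀' hk] at this

/-- After squaring and clearing denominators the constant terms cancel, leaving c times a quintic to
be shown nonnegative. -/
theorem le_sqrt_bound_fourth (hc : 2.71569 < c) (hc3 : c ≤ 3) :
    1 + c / 18 - c ^ 2 / 72 ≤
      (54 + c) / 27 * Real.sqrt (4 * (54 + c) / (3 * (288 + 8 * c - c ^ 2))) := by
  have hd : 0 < 288 + 8 * c - c ^ 2 := by nlinarith
  have hp : 0 < 54 + c := by linarith
  refine le_mul_sqrt_of_sq_le (by positivity) ?_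
  rw [div_pow, div_le_div_iff₀ (by positivity) (by positivity)]
  have hc0 : 0 < c := by linarith
  -- Expanded at the left endpoint, the quintic has a positive constant term that absorbs the
  -- negative cubic and quartic terms.
  obtain ⟨t, rfl⟩ : ∃ t, c = 2.71569 + t := ⟨c - 2.71569, by ring⟩
  have ht : 0 < t := by linarith
  have ht1 : t ≤ 0.28431 := by linarith
  have key : 0 ≤ (2.71569 + t) * (-272097792 + 85240512 * (2.71569 + t) +
      8558784 * (2.71569 + t) ^ 2 - 769824 * (2.71569 + t) ^ 3 - 34992 * (2.71569 + t) ^ 4 +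
      2187 * (2.71569 + t) ^ 5) := by
    refine mul_nonneg hc0.le ?_
    have t2 : t ^ 2 ≤ 0.28431 ^ 2 := pow_le_pow_left₀ ht.le ht1 2
    have t3 : t ^ 3 ≤ 0.28431 ^ 3 := pow_le_pow_left₀ ht.le ht1 3
    have t4 : t ^ 4 ≤ 0.28431 ^ 4 := pow_le_pow_left₀ ht.le ht1 4
    have t5 : 0 ≤ t ^ 5 := by positivity
    have t20 : 0 ≤ t ^ 2 := by positivity
    ring_nf
    norm_num at t2 t3 t4
    linarith
  linarith [key]

theorem le_sqrt_bound_fifth (hc : 1.35541 < c) (hc3 : c ≤ 3) :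
    1 + c / 10 - c ^ 2 / 20 ≤
      (30 + c) / 15 * Real.sqrt (2 * (30 + c) / (3 * (80 + 4 * c - c ^ 2))) := by
  have hd : 0 < 80 + 4 * c - c ^ 2 := by nlinarith
  have hp : 0 < 30 + c := by linarith
  refine le_mul_sqrt_of_sq_le (by positivity) ?_
  rw [div_pow, div_le_div_iff₀ (by positivity) (by positivity)]
  have hc0 : 0 < c := by linarith
  obtain ⟨t, rfl⟩ : ∃ t, c = 1.35541 + t := ⟨c - 1.35541, by ring⟩
  have ht : 0 < t := by linarith
  have ht1 : t ≤ 1.64459 := by linarith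
  have key : 0 ≤ (1.35541 + t) * (-129600 + 82800 * (1.35541 + t) +
      14720 * (1.35541 + t) ^ 2 - 2700 * (1.35541 + t) ^ 3 - 216 * (1.35541 + t) ^ 4 +
      27 * (1.35541 + t) ^ 5) := by
    refine mul_nonneg hc0.le ?_
    have t2 : t ^ 2 ≤ 1.64459 ^ 2 := pow_le_pow_left₀ ht.le ht1 2
    -- On this longer interval the negative terms are bounded by multiples of t, to be absorbed by
    -- the linear term.
    have t3 : t * t ^ 2 ≤ t * 1.64459 ^ 2 := mul_le_mul_of_nonneg_left t2 ht.le
    have t4 : t * t ^ 3 ≤ t * 1.64459 ^ 3 :=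
      mul_le_mul_of_nonneg_left (pow_le_pow_left₀ ht.le ht1 3) ht.le
    have t5 : 0 ≤ t ^ 5 := by positivity
    have t20 : 0 ≤ t ^ 2 := by positivity
    ring_nf at t3 t4 ⊢
    norm_num at t3 t4
    linarith
  linarith [key]

end Bounds

/-! ### The extremal function -/

section Extremal

open Filter Topology

variable {c : ℝ}

theorem one_sub_mem_slitPlane {z : ℂ} (hz : z ∈ Metric.ball (0 : ℂ) 1) :
    1 - z ∈ Complex.slitPlane := by
  refine Or.inl ?_
  rw [Complex.sub_re, Complex.one_re]
  have := (Complex.re_le_norm z).trans_lt (mem_ball_zero_iff.1 hz)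
  linarith

theorem hasDerivAt_extremalF (c : ℝ) {z : ℂ} (hz : z ∈ Metric.ball (0 : ℂ) 1) :
    HasDerivAt (extremalF c) ((1 - z) ^ (-(c : ℂ))) z := by
  have hs := one_sub_mem_slitPlane hz
  have h1 : HasDerivAt (fun z : ℂ => 1 - z) (-1) z := by
    simpa using (hasDerivAt_id z).const_sub 1
  by_cases hc : c = 1
  · have e : extremalF c = fun z => -Complex.log (1 - z) := by
      ext w; rw [extremalF, if_pos hc]
    rw [e, hc, Complex.ofReal_one, Complex.cpow_neg_one]
    refine (h1.clog hs).neg.congr_deriv ?_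
    rw [neg_div, neg_neg, one_div]
  · have e : extremalF c = fun z => ((1 - z) ^ (1 - (c : ℂ)) - 1) / ((c : ℂ) - 1) := by
      ext w; rw [extremalF, if_neg hc]
    have hc' : (c : ℂ) - 1 ≠ 0 := by
      rw [sub_ne_zero]; exact_mod_cast hc
    rw [e]
    refine (((h1.cpow_const (c := 1 - (c : ℂ)) hs).sub_const 1).div_const
      ((c : ℂ) - 1)).congr_deriv ?_
    rw [show (1 - (c : ℂ) - 1) = -(c : ℂ) by ring]
    field_simp
    ring

theorem deriv_deriv_extremalF (c : ℝ) {z : ℂ} (hz : z ∈ Metric.ball (0 : ℂ) 1) :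
    deriv (deriv (extremalF c)) z = (1 - z) ^ (-(c : ℂ)) * (c / (1 - z)) := by
  have hs := one_sub_mem_slitPlane hz
  have e : deriv (extremalF c) =ᶠ[𝓝 z] fun z => (1 - z) ^ (-(c : ℂ)) := by
    filter_upwards [Metric.isOpen_ball.mem_nhds hz] with w hw
    exact (hasDerivAt_extremalF c hw).deriv
  have h1 : HasDerivAt (fun z : ℂ => 1 - z) (-1) z := by
    simpa using (hasDerivAt_id z).const_sub 1
  rw [e.deriv_eq, (h1.cpow_const (c := -(c : ℂ)) hs).deriv,
    Complex.cpow_sub _ _ (Complex.slitPlane_ne_zero hs), Complex.cpow_one]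
  ring

theorem isNormalizedAnalytic_extremalF (c : ℝ) : IsNormalizedAnalytic (extremalF c) where
  differentiableOn := fun z hz =>
    (hasDerivAt_extremalF c hz).differentiableAt.differentiableWithinAt
  map_zero := by simp [extremalF]
  deriv_zero := by
    rw [(hasDerivAt_extremalF c (Metric.mem_ball_self one_pos)).deriv]; simp

/-- Multiplied by |1 - z|^2, the inequality becomes |z|^2 < 1. -/
theorem neg_half_lt_re_div_one_sub {z : ℂ} (hz : z ∈ Metric.ball (0 : ℂ) 1) :
    -(1 / 2) < (z / (1 - z)).re := by
  have h0 : 1 - z ≠ 0 := Complex.slitPlane_ne_zero (one_sub_mem_slitPlane hz)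
  have hz1 : Complex.normSq z < 1 := by
    rw [Complex.normSq_eq_norm_sq]
    have := mem_ball_zero_iff.1 hz
    nlinarith [norm_nonneg z]
  have hp : 0 < Complex.normSq (1 - z) := Complex.normSq_pos.2 h0
  rw [Complex.div_re, ← add_div, lt_div_iff₀ hp]
  simp only [Complex.normSq_apply, Complex.sub_re, Complex.one_re, Complex.sub_im,
    Complex.one_im] at *
  nlinarith

theorem extremalF_mem_classF (hc : 0 < c) : extremalF c ∈ classF c := by
  refine ⟨isNormalizedAnalytic_extremalF c, fun z hz => ?_⟩
  have h0 : 1 - z ≠ 0 := Complex.slitPlane_ne_zero (one_sub_mem_slitPlane hz)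
  have h1 : (1 - z) ^ (-(c : ℂ)) ≠ 0 := by simp [Complex.cpow_eq_zero_iff, h0]
  rw [deriv_deriv_extremalF c hz, (hasDerivAt_extremalF c hz).deriv]
  refine ⟨h1, ?_⟩
  have e : z * ((1 - z) ^ (-(c : ℂ)) * (c / (1 - z))) / (1 - z) ^ (-(c : ℂ)) =
      (c : ℂ) * (z / (1 - z)) := by
    field_simp
  rw [e, Complex.add_re, Complex.one_re, Complex.re_ofReal_mul]
  nlinarith [mul_lt_mul_of_pos_left (neg_half_lt_re_div_one_sub hz) hc]

/-- The identity z/(1 - z) = z(1 + z/(1 - z)) shifts coefficients by one, which gives an induction.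
-/
theorem taylorCoeff_div_one_sub (n : ℕ) :
    taylorCoeff (fun z => z / (1 - z)) n = if n = 0 then 0 else 1 := by
  have ha : AnalyticAt ℂ (fun z : ℂ => z / (1 - z)) 0 :=
    analyticAt_id.div (analyticAt_const.sub analyticAt_id) (by simp)
  have e : (fun z : ℂ => z / (1 - z)) =ᶠ[𝓝 0] fun z => z * (1 + z / (1 - z)) := by
    filter_upwards [Metric.ball_mem_nhds (0 : ℂ) one_pos] with z hz
    have h0 : 1 - z ≠ 0 := Complex.slitPlane_ne_zero (one_sub_mem_slitPlane hz)
    field_simp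
    ring
  have hs : ∀ n, taylorCoeff (fun z => z / (1 - z)) (n + 1) = 1 := by
    intro n
    rw [taylorCoeff_congr e, taylorCoeff_id_mul_succ (analyticAt_const.fun_add ha),
      taylorCoeff_add analyticAt_const ha]
    induction n with
    | zero => simp [taylorCoeff_zero]
    | succ n ih =>
      rw [taylorCoeff_const_of_ne_zero _ n.succ_ne_zero, taylorCoeff_congr e,
        taylorCoeff_id_mul_succ (analyticAt_const.fun_add ha),
        taylorCoeff_add analyticAt_const ha, ih, zero_add]
  cases n with
  | zero => simp [taylorCoeff_zero]
  | succ n => simp [hs]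

/-- For f_c one has z f''/f' = cz/(1 - z), so q_n = 1 for all n ≥ 1. -/
theorem logCoeff_extremalF (c : ℝ) :
    logCoeff (extremalF c) 1 = (c / 4 : ℝ) ∧
    logCoeff (extremalF c) 2 = (1 / 48 * (4 * c + c ^ 2) : ℝ) ∧
    logCoeff (extremalF c) 3 = (1 / 48 * (2 * c + c ^ 2) : ℝ) ∧
    logCoeff (extremalF c) 4 = (1 / 40 * (c + c ^ 2 / 18 * (13 + c / 2 - c ^ 2 / 8)) : ℝ) ∧
    logCoeff (extremalF c) 5 = (1 / 60 * (c + c ^ 2 / 12 * (11 + c - c ^ 2 / 4)) : ℝ) := by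
  have ha : AnalyticAt ℂ (fun z : ℂ => z / (1 - z)) 0 :=
    analyticAt_id.div (analyticAt_const.sub analyticAt_id) (by simp)
  have hS : ∀ᶠ z in 𝓝 (0 : ℂ), (c : ℂ) * (z / (1 - z)) * deriv (extremalF c) z =
      z * deriv (deriv (extremalF c)) z := by
    filter_upwards [Metric.ball_mem_nhds (0 : ℂ) one_pos] with z hz
    rw [deriv_deriv_extremalF c hz, (hasDerivAt_extremalF c hz).deriv]
    ring
  obtain ⟨h1, h2, h3, h4, h5⟩ := (isNormalizedAnalytic_extremalF c).logCoeff_formulas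
    (analyticAt_const.fun_mul ha) hS (by simp) (c := c)
    (q := fun n => if n = 0 then 0 else 1)
    (fun n => by rw [taylorCoeff_const_mul, taylorCoeff_div_one_sub])
  norm_num at h1 h2 h3 h4 h5
  rw [h1, h2, h3, h4, h5]
  push_cast
  refine ⟨rfl, ?_, ?_, ?_, ?_⟩ <;> ring

end Extremal

/-! ### Bounds in the class -/

section ClassF

open Filter Topology

variable {c : ℝ} {f : ℂ → ℂ}

/-- The coefficients of `z f'' / (c f')` for `f` in the class `F(c)`. -/
theorem exists_coeff_of_mem_classF (hc : 0 < c) (hf : f ∈ classF c) :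
    ∃ (S : ℂ → ℂ) (q : ℕ → ℂ), AnalyticAt ℂ S 0 ∧ S 0 = 0 ∧
      (∀ᶠ z in 𝓝 0, S z * deriv f z = z * deriv (deriv f) z) ∧
      (∀ n, taylorCoeff S n = c * q n) ∧ (∀ n ≠ 0, ‖q n‖ ≤ 1) ∧
      ‖q 2 - q 1 ^ 2‖ ≤ 1 - ‖q 1‖ ^ 2 ∧
      ‖q 3 - q 1 ^ 3‖ ≤ (1 + 2 * ‖q 1‖) * (1 - ‖q 1‖ ^ 2) := by
  obtain ⟨hn, hf'⟩ := hf
  have hb : Metric.ball (0 : ℂ) 1 ∈ 𝓝 (0 : ℂ) := Metric.ball_mem_nhds _ one_pos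
  have hc' : (c : ℂ) ≠ 0 := by exact_mod_cast hc.ne'
  set S : ℂ → ℂ := fun z => z * deriv (deriv f) z / deriv f z with hSdef
  have hd1 := hn.differentiableOn.deriv Metric.isOpen_ball
  have hd2 := hd1.deriv Metric.isOpen_ball
  have hS : DifferentiableOn ℂ S (Metric.ball 0 1) :=
    (differentiableOn_id.mul hd2).div hd1 fun z hz => (hf' z hz).1
  have hSa : AnalyticAt ℂ S 0 := hS.analyticAt hb
  have hS0 : S 0 = 0 := by simp [hSdef]
  -- Since Re S > -c/2, the function 1/2 + S/c has positive real part and value 1/2 at 0.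
  have hP : DifferentiableOn ℂ (fun z => 1 / 2 + ((c⁻¹ : ℝ) : ℂ) * S z) (Metric.ball 0 1) :=
    (hS.const_mul _).const_add _
  obtain ⟨b1, b2, b3⟩ := coeff_bounds_of_re_nonneg hP (by simp [hS0]) (fun z hz => by
    have h := (hf' z hz).2
    rw [Complex.add_re, Complex.one_re] at h
    have h' : -(c / 2) < (S z).re := by linarith
    rw [Complex.add_re, Complex.re_ofReal_mul, inv_mul_eq_div]
    have h2 : -(1 / 2) < (S z).re / c := by
      rw [lt_div_iff₀ hc]; linarith
    have h3 : (1 / 2 : ℂ).re = 1 / 2 := by norm_num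
    rw [h3]; linarith)
  have hq : ∀ n ≠ 0, taylorCoeff (fun z => 1 / 2 + ((c⁻¹ : ℝ) : ℂ) * S z) n =
      taylorCoeff S n / c := fun n h => by
    rw [taylorCoeff_add analyticAt_const (analyticAt_const.fun_mul hSa),
      taylorCoeff_const_of_ne_zero _ h, taylorCoeff_const_mul, zero_add, Complex.ofReal_inv,
      inv_mul_eq_div]
  rw [hq 1 one_ne_zero, hq 2 two_ne_zero] at b2
  rw [hq 1 one_ne_zero, hq 3 three_ne_zero] at b3
  refine ⟨S, fun n => taylorCoeff S n / c, hSa, hS0, ?_, fun n => (mul_div_cancel₀ _ hc').symm,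
    fun n h => (congrArg norm (hq n h)).symm.trans_le (b1 n h), b2, b3⟩
  filter_upwards [hb] with z hz
  exact div_mul_cancel₀ _ (hf' z hz).1

/-- Sharp bounds for the first five logarithmic coefficients in `F(c)`, valid for all
`0 < c ≤ 3`. -/
theorem norm_logCoeff_le (hc0 : 0 < c) (hc3 : c ≤ 3) (hf : f ∈ classF c) :
    ‖logCoeff f 1‖ ≤ c / 4 ∧
    ‖logCoeff f 2‖ ≤ 1 / 48 * (4 * c + c ^ 2) ∧
    ‖logCoeff f 3‖ ≤ 1 / 48 * (2 * c + c ^ 2) ∧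
    ‖logCoeff f 4‖ ≤ c / 40 * (1 + 2 * c / 9 + c / 2 * (1 + c / 18 - c ^ 2 / 72)) ∧
    ‖logCoeff f 5‖ ≤ c / 60 * (1 + c / 2 + c ^ 2 / 24 +
      5 * c / 12 * (1 + c / 10 - c ^ 2 / 20)) := by
  obtain ⟨S, q, hSa, hS0, hS, hq, hb, b2, b3⟩ := exists_coeff_of_mem_classF hc0 hf
  obtain ⟨e1, e2, e3, e4, e5⟩ := hf.1.logCoeff_formulas hSa hS hS0 hq
  have h1 := hb 1 one_ne_zero
  have h2 := hb 2 two_ne_zero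
  have h3 := hb 3 three_ne_zero
  have h4 := hb 4 four_ne_zero
  have h5 := hb 5 (by norm_num)
  have hmul : ∀ {k : ℝ} {x : ℂ} {B : ℝ}, 0 ≤ k → ‖x‖ ≤ B → ‖(k : ℂ) * x‖ ≤ k * B := by
    intro k x B hk hx
    rw [norm_mul, Complex.norm_real, Real.norm_of_nonneg hk]
    exact mul_le_mul_of_nonneg_left hx hk
  have h11 : ‖q 1 ^ 2‖ ≤ 1 := by rw [norm_pow]; exact pow_le_one₀ (norm_nonneg _) h1
  have h12 : ‖q 1 * q 2‖ ≤ 1 := by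
    rw [norm_mul]; exact mul_le_one₀ h1 (norm_nonneg _) h2
  refine ⟨?_, ?_, ?_, ?_, ?_⟩
  · have := hmul (k := c / 4) (by positivity) h1
    rw [e1]; push_cast at this; linarith
  · have := hmul (k := c / 12) (by positivity)
      (norm_add_ofReal_mul_le (t := c / 4) (by positivity) h2 h11)
    rw [e2]; push_cast at this; linarith
  · have := hmul (k := c / 24) (by positivity)
      (norm_add_ofReal_mul_le (t := c / 2) (by positivity) h3 h12)
    rw [e3, mul_assoc (_ / _) (q 1)]; push_cast at this; linarith
  · convert hmul (k := c / 40) (by positivity) (norm_fourth_le hc0.le hc3 h1 h2 h3 h4 b2) using 2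
    rw [e4]; push_cast; ring
  · convert hmul (k := c / 60) (by positivity)
      (norm_fifth_le hc0.le hc3 h1 h2 h3 h4 h5 b2 b3) using 2
    rw [e5]; push_cast; ring

end ClassF

theorem theorem5 (c : ℝ) (hc0 : 0 < c) (hc3 : c ≤ 3) :
    (∀ f ∈ classF c,
      ‖logCoeff f 1‖ ≤ c / 4 ∧
      ‖logCoeff f 2‖ ≤ 1 / 48 * (4 * c + c ^ 2) ∧
      ‖logCoeff f 3‖ ≤ 1 / 48 * (2 * c + c ^ 2) ∧
      (c ≤ 144 / 55 →
        ‖logCoeff f 4‖ ≤ 1 / 40 * (c + c ^ 2 / 18 * (13 + c / 2 - c ^ 2 / 8))) ∧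
      (2.71569 < c →
        ‖logCoeff f 4‖ ≤ 1 / 40 * (c + 2 * c ^ 2 / 9 + c ^ 2 / 2 *
          ((54 + c) / 27 * Real.sqrt (4 * (54 + c) / (3 * (288 + 8 * c - c ^ 2)))))) ∧
      (c < 1.31148 →
        ‖logCoeff f 5‖ ≤ 1 / 60 * (c + c ^ 2 / 12 * (11 + c - c ^ 2 / 4))) ∧
      (1.35541 < c →
        ‖logCoeff f 5‖ ≤ 1 / 60 * (c + c ^ 2 / 2 + c ^ 3 / 24 + 5 * c ^ 2 / 12 *
          ((30 + c) / 15 * Real.sqrt (2 * (30 + c) / (3 * (80 + 4 * c - c ^ 2))))))) ∧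
    (extremalF c ∈ classF c ∧
      ‖logCoeff (extremalF c) 1‖ = c / 4 ∧
      ‖logCoeff (extremalF c) 2‖ = 1 / 48 * (4 * c + c ^ 2) ∧
      ‖logCoeff (extremalF c) 3‖ = 1 / 48 * (2 * c + c ^ 2) ∧
      (c ≤ 144 / 55 →
        ‖logCoeff (extremalF c) 4‖ =
          1 / 40 * (c + c ^ 2 / 18 * (13 + c / 2 - c ^ 2 / 8))) ∧
      (c ≤ 80 / 61 →
        ‖logCoeff (extremalF c) 5‖ =
          1 / 60 * (c + c ^ 2 / 12 * (11 + c - c ^ 2 / 4)))) := by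
  refine ⟨fun f hf => ?_, extremalF_mem_classF hc0, ?_⟩
  · obtain ⟨h1, h2, h3, h4, h5⟩ := norm_logCoeff_le hc0 hc3 hf
    refine ⟨h1, h2, h3, fun _ => h4.trans_eq (by ring), fun hc => h4.trans ?_,
      fun _ => h5.trans_eq (by ring), fun hc => h5.trans ?_⟩
    -- The weights are c^2/80 = (1/40)(c^2/2) here and c^2/144 = (1/60)(5c^2/12) for γ_5.
    · have := mul_le_mul_of_nonneg_left (le_sqrt_bound_fourth hc hc3)
        (by positivity : 0 ≤ c ^ 2 / 80)
      linarith
    · have := mul_le_mul_of_nonneg_left (le_sqrt_bound_fifth hc hc3)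
        (by positivity : 0 ≤ c ^ 2 / 144)
      linarith
  · obtain ⟨h1, h2, h3, h4, h5⟩ := logCoeff_extremalF c
    have c9 : c ^ 2 ≤ 9 := by nlinarith
    have p4 : 0 ≤ 13 + c / 2 - c ^ 2 / 8 := by linarith
    have p5 : 0 ≤ 11 + c - c ^ 2 / 4 := by linarith
    rw [h1, h2, h3, h4, h5]
    simp only [Complex.norm_real]
    exact ⟨Real.norm_of_nonneg (by positivity), Real.norm_of_nonneg (by positivity),
      Real.norm_of_nonneg (by positivity), fun _ => Real.norm_of_nonneg (by positivity),
      fun _ => Real.norm_of_nonneg (by positivity)⟩
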